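/- There is a universal constant $C>0$ such that the following holds. Let $d\ge 0$, $V\subset\mathbb R^d$, $n\ge 2$, and let $(X_1,Y_1),\dots,(X_n,Y_n)$ be i.i.d. with law $P$ on $\mathbb R^d\times\mathcal Y$ ($\mathcal Y$ a measurable space), with empirical distribution $P_n$. Let $\widehat C(x)=\{y\in\mathcal Y : s(x,y)\ge q(x)\}$, where the scoring function $s:\mathbb R^d\times\mathcal Y\to\mathbb R$ and the threshold function $q:\mathbb R^d\to\mathbb R$ are arbitrary (up to measurability) and may be random but are independent of the sample; below, $P(Y\in\widehat C(X)\mid\cdot)$ is taken with $\widehat C$ held fixed. Let $S_{v,a,b}=\{x\in\mathbb R^d : a\le v^Tx\le b\}$, and let $\mathrm{VC}(V)$ be the VC-dimension of the collection of halfspaces $\{x : v^Tx\le 0\}$, $v\in V$. Then $\mathrm{VC}(V)\le\min\{d,\log_2|V|\}$ (with the convention $\log_2|V|=0$ if $V=\emptyset$), and for all $0<\delta\le 1$ and all $t>0$, with probability at least $1-e^{-t}$, $$\sup_{v\in V,\ a\le b\,:\,P_n(X\in S_{v,a,b})\ge\delta}\bigl|P_n(Y\in\widehat C(X)\mid X\in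 S_{v,a,b})-P(Y\in\widehat C(X)\mid X\in S_{v,a,b})\bigr|\le C\sqrt{\frac{\max\{1,\mathrm{VC}(V)\}\log n+t}{\delta n}}\le C\sqrt{\frac{\max\{1,\min\{d,\log_2|V|\}\}\log n+t}{\delta n}} .$$ Here $P(Y\in\widehat C(X)\mid X\in S)$ is read as $0$ when $P(X\in S)=0$; if the event is not measurable, the claim is that its complement has outer probability at most $e^{-t}$. -/

import Mathlib

open MeasureTheory ProbabilityTheory

noncomputable section

/-- The family `F` of subsets of `α` shatters the finite set `A`: every subset of `A` is the trace
on `A` of a member of `F`. -/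
def ShattersSet {α : Type*} (F : Set (Set α)) (A : Finset α) : Prop :=
  ∀ B : Set α, B ⊆ (A : Set α) → ∃ S ∈ F, S ∩ (A : Set α) = B

/-- The VC-dimension of a family of sets: the supremum of the cardinalities of the finite sets that
it shatters (`⊤` if these are unbounded, `0` for the empty family). -/
def vcDimension {α : Type*} (F : Set (Set α)) : ℕ∞ :=
  ⨆ A : {A : Finset α // ShattersSet F A}, (A.1.card : ℕ∞)

/-- The collection of halfspaces `{x | vᵀ x ≤ 0}`, `v ∈ V`. -/
def halfspaces {d : ℕ} (V : Set (EuclideanSpace ℝ (Fin d))) :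
    Set (Set (EuclideanSpace ℝ (Fin d))) :=
  (fun v => {x | inner ℝ v x ≤ 0}) '' V

/-- `VC(V)`: the VC-dimension of the collection of halfspaces induced by `V`. -/
def VC {d : ℕ} (V : Set (EuclideanSpace ℝ (Fin d))) : ℕ∞ :=
  vcDimension (halfspaces V)

open Classical in
/-- `min {d, log₂ |V|}`, which is `d` if `V` is infinite. -/
def minDimLogCard {d : ℕ} (V : Set (EuclideanSpace ℝ (Fin d))) : ℝ :=
  if V.Finite then min (d : ℝ) (Real.logb 2 V.ncard) else d

/-- The slab `S_{v,a,b} = {x | a ≤ vᵀ x ≤ b}`. -/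
def slab {d : ℕ} (v : EuclideanSpace ℝ (Fin d)) (a b : ℝ) : Set (EuclideanSpace ℝ (Fin d)) :=
  {x | a ≤ inner ℝ v x ∧ inner ℝ v x ≤ b}

/-- The confidence set mapping of threshold form, `C(x) = {y | s(x, y) ≥ q(x)}`. -/
def thresholdSet {X Y : Type*} (s : X → Y → ℝ) (q : X → ℝ) (x : X) : Set Y :=
  {y | q x ≤ s x y}

/-- The empirical distribution of the sample `z 0, …, z (n - 1)`. -/
def empiricalDist {Z : Type*} [MeasurableSpace Z] {n : ℕ} (z : Fin n → Z) : Measure Z :=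
  (n : ENNReal)⁻¹ • ∑ i, Measure.dirac (z i)

/-- `Q(X ∈ S)` for a distribution `Q` of the pair `(X, Y)`. -/
def slabMass {X Y : Type*} [MeasurableSpace X] [MeasurableSpace Y] (Q : Measure (X × Y))
    (S : Set X) : ℝ :=
  Q.real {z | z.1 ∈ S}

/-- The conditional coverage `Q(Y ∈ C(X) | X ∈ S)` for a distribution `Q` of the pair `(X, Y)`,
with value `0` if `Q(X ∈ S) = 0`. -/
def condCoverage {X Y : Type*} [MeasurableSpace X] [MeasurableSpace Y] (Q : Measure (X × Y))
    (C : X → Set Y) (S : Set X) : ℝ :=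
  (ProbabilityTheory.cond Q {z | z.1 ∈ S}).real {z | z.2 ∈ C z.1}

end

/-! Each coverage is the mass of slab ∩ C divided by the mass of the slab, so it suffices to control
the counts of both families of sets uniformly. The control must be relative: a count k differs from
its mean by at most 5r(√k + r), with r² of order max{1, VC(V)} log n + t. Dividing by k ≥ δn leaves
r/√(δn), where an absolute error r√n would leave r/(δ√n).

Uniformity comes from symmetrization. A ghost sample replaces the mean (`measure_deviation_le`);
random swaps between the two samples, Hoeffding for each trace and a union bound over traces do the
rest (`measure_ghost_deviation_le`). Traces are few (`card_slab_traces_le`): a nonempty slab trace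
is fixed by its two extreme points and the order of the vᵀxᵢ, that is, by a halfspace trace on the
(2n)² differences xᵢ - xⱼ, to which Sauer-Shelah applies with VC(V). Intersecting with a fixed C
creates no new traces. Independence allows C to be frozen (`measure_section_deviation_le`), and
approximation by countably many slabs handles measurability (`slab_deviation_le_of_dense`). -/

/-! ### VC-dimension of homogeneous halfspaces -/

theorem vcDimension_le {α : Type*} {F : Set (Set α)} {m : ℕ∞}
    (h : ∀ A : Finset α, ShattersSet F A → (A.card : ℕ∞) ≤ m) : vcDimension F ≤ m :=
  iSup_le fun A => h A.1 A.2

theorem ShattersSet.card_le_vcDimension {α : Type*} {F : Set (Set α)} {A : Finset α}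
    (h : ShattersSet F A) : (A.card : ℕ∞) ≤ vcDimension F :=
  le_iSup (fun A : {A : Finset α // ShattersSet F A} => (A.1.card : ℕ∞)) ⟨A, h⟩

/-- More than d points satisfy a nontrivial relation ∑ c e • e = 0. A halfspace cutting out exactly
the points with c e ≤ 0 makes every c e * ⟪v, e⟫ nonnegative, and positive where c e > 0, yet these
terms sum to 0. -/
theorem VC_le_dim {d : ℕ} (V : Set (EuclideanSpace ℝ (Fin d))) : VC V ≤ (d : ℕ∞) := by
  refine vcDimension_le fun A hA => ?_
  by_contra! hlt
  have hlt' : Module.finrank ℝ (EuclideanSpace ℝ (Fin d)) < A.card := by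
    rw [finrank_euclideanSpace_fin]; exact_mod_cast hlt
  obtain ⟨f, hf, x₀, hx₀, hne⟩ := Module.exists_nontrivial_relation_of_finrank_lt_card hlt'
  have key : ∀ c : EuclideanSpace ℝ (Fin d) → ℝ, ∑ e ∈ A, c e • e = 0 →
      ∀ x ∈ A, ¬ 0 < c x := by
    intro c hc x hx hpos
    obtain ⟨S, ⟨v, -, rfl⟩, hS⟩ := hA {e | e ∈ A ∧ c e ≤ 0} (fun e he => he.1)
    have hmem : ∀ e ∈ A, (inner ℝ v e ≤ 0 ↔ c e ≤ 0) := by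
      intro e he
      have := Set.ext_iff.1 hS e
      simpa [he] using this
    have h0 : ∑ e ∈ A, c e * inner ℝ v e = 0 := by
      have := congrArg (fun y => inner ℝ v y) hc
      simpa [inner_sum, inner_smul_right] using this
    have hpos' : 0 < ∑ e ∈ A, c e * inner ℝ v e := by
      refine Finset.sum_pos' (fun e he => ?_) ⟨x, hx, ?_⟩
      · by_cases h : c e ≤ 0
        · exact mul_nonneg_of_nonpos_of_nonpos h ((hmem e he).2 h)
        · have h' : ¬ inner ℝ v e ≤ 0 := fun h' => h ((hmem e he).1 h')
          exact mul_nonneg (not_le.1 h).le (not_le.1 h').le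
      · have h' : ¬ inner ℝ v x ≤ 0 := fun h' => not_le.2 hpos ((hmem x hx).1 h')
        exact mul_pos hpos (not_le.1 h')
    exact hpos'.ne' h0
  -- Strictness needs a positive coefficient, so the relation is negated if necessary.
  rcases lt_or_gt_of_ne hne with h | h
  · exact key (fun e => - f e) (by simp [hf]) x₀ hx₀ (by simpa using h)
  · exact key f hf x₀ hx₀ h

theorem VC_lt_top {d : ℕ} (V : Set (EuclideanSpace ℝ (Fin d))) : VC V < ⊤ :=
  (VC_le_dim V).trans_lt (ENat.natCast_lt_top d)

theorem ShattersSet.two_pow_card_le {α : Type*} {F : Set (Set α)} (hF : F.Finite) {A : Finset α}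
    (h : ShattersSet F A) : 2 ^ A.card ≤ F.ncard := by
  classical
  have hsub : (fun B : Finset α => (B : Set α)) '' (A.powerset : Set (Finset α)) ⊆ (fun S => S ∩ (A : Set α)) '' F := by
    rintro _ ⟨B, hB, rfl⟩
    obtain ⟨S, hS, hSB⟩ := h B (by simpa using hB)
    exact ⟨S, hS, hSB⟩
  have h1 := (Set.ncard_le_ncard hsub (hF.image _)).trans (Set.ncard_image_le hF)
  rwa [Set.ncard_image_of_injective _ Finset.coe_injective, Set.ncard_coe_finset,
    Finset.card_powerset] at h1

theorem VC_toNat_le_minDimLogCard {d : ℕ} (V : Set (EuclideanSpace ℝ (Fin d))) :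
    ((VC V).toNat : ℝ) ≤ minDimLogCard V := by
  have hd : ((VC V).toNat : ℝ) ≤ d := by
    exact_mod_cast ENat.toNat_le_of_le_natCast (VC_le_dim V)
  unfold minDimLogCard
  split_ifs with hV
  · refine le_min hd ?_
    -- Cardinalities are integers, so the floor of the logarithm is also a bound; for empty `V` both
    -- logarithms are 0 by convention.
    have hle : VC V ≤ (Nat.log 2 V.ncard : ℕ) := by
      refine vcDimension_le fun A hA => ?_
      have h1 := hA.two_pow_card_le (hV.image _)
      have h2 := h1.trans (Set.ncard_image_le hV)
      exact_mod_cast Nat.le_log_of_pow_le one_lt_two h2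
    calc ((VC V).toNat : ℝ) ≤ (Nat.log 2 V.ncard : ℕ) := by
          exact_mod_cast ENat.toNat_le_of_le_natCast hle
      _ ≤ Real.logb 2 V.ncard := by exact_mod_cast Real.natLog_le_logb V.ncard 2
  · exact hd

/-! ### Counting traces -/

theorem Nat.sum_choose_le_succ_pow (m v : ℕ) :
    ∑ k ∈ Finset.Iic v, m.choose k ≤ (m + 1) ^ v := by
  have h : Finset.Iic v = Finset.range (v + 1) := by ext; simp
  rw [h, add_pow]
  refine Finset.sum_le_sum fun k hk => ?_
  have hk' : k ≤ v := Nat.lt_succ_iff.1 (Finset.mem_range.1 hk)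
  calc m.choose k ≤ m ^ k := Nat.choose_le_pow _ _
    _ ≤ m ^ k * 1 ^ (v - k) * v.choose k := by
        simpa using Nat.le_mul_of_pos_right _ (Nat.choose_pos hk')

/-- **Sauer-Shelah** for the traces on a finite family of points of a family of sets. -/
theorem card_traces_le {α κ : Type*} [Fintype κ] (F : Set (Set α)) (y : κ → α) {m : ℕ}
    (hF : vcDimension F ≤ m) :
    {W : Finset κ | ∃ S ∈ F, ∀ k, k ∈ W ↔ y k ∈ S}.ncard ≤ (Fintype.card κ + 1) ^ m := by
  classical
  set 𝒲 : Set (Finset κ) := {W | ∃ S ∈ F, ∀ k, k ∈ W ↔ y k ∈ S}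
  have hfin : 𝒲.Finite := Set.toFinite _
  have hvc : hfin.toFinset.vcDim ≤ m := by
    refine Finset.sup_le fun s hs => ?_
    rw [Finset.mem_shatterer] at hs
    -- Indices carrying the same point cannot be separated, so shattered indices carry distinct
    -- points.
    have hinj : Set.InjOn y s := by
      intro k hk l hl hkl
      obtain ⟨W, hW, hWs⟩ := hs (t := {k}) (by simpa using hk)
      obtain ⟨S, -, hS⟩ := hfin.mem_toFinset.1 hW
      have h1 : k ∈ W := (Finset.mem_inter.1 (hWs ▸ Finset.mem_singleton_self k)).2
      have h2 : l ∈ s ∩ W := Finset.mem_inter.2 ⟨hl, (hS l).2 (hkl ▸ (hS k).1 h1)⟩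
      rw [hWs, Finset.mem_singleton] at h2
      exact h2.symm
    have hsh : ShattersSet F (s.image y) := by
      intro B hB
      obtain ⟨W, hW, hWs⟩ := hs (t := s.filter fun k => y k ∈ B) (Finset.filter_subset _ _)
      obtain ⟨S, hSF, hS⟩ := hfin.mem_toFinset.1 hW
      refine ⟨S, hSF, ?_⟩
      have hk : ∀ k ∈ s, (y k ∈ S ↔ y k ∈ B) := by
        intro k hk
        have := Finset.ext_iff.1 hWs k
        simpa [hk, hS] using this
      ext z
      constructor
      · rintro ⟨hz, hz'⟩
        obtain ⟨k, hks, rfl⟩ := Finset.mem_image.1 (Finset.mem_coe.1 hz')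
        exact (hk k hks).1 hz
      · intro hz
        obtain ⟨k, hks, rfl⟩ := Finset.mem_image.1 (Finset.mem_coe.1 (hB hz))
        exact ⟨(hk k hks).2 hz, hB hz⟩
    have := hsh.card_le_vcDimension.trans hF
    rw [Finset.card_image_of_injOn hinj] at this
    exact_mod_cast this
  rw [Set.ncard_eq_toFinset_card _ hfin]
  calc hfin.toFinset.card ≤ hfin.toFinset.shatterer.card := Finset.card_le_card_shatterer _
    _ ≤ ∑ k ∈ Finset.Iic hfin.toFinset.vcDim, (Fintype.card κ).choose k :=
        Finset.card_shatterer_le_sum_vcDim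
    _ ≤ (Fintype.card κ + 1) ^ hfin.toFinset.vcDim := Nat.sum_choose_le_succ_pow _ _
    _ ≤ _ := Nat.pow_le_pow_right (Nat.succ_pos _) hvc

/-- The traces of the slabs `S_{v,a,b}`, `v ∈ V`, on finitely many points: the order of the `vᵀ xᵢ`
is determined by the trace of a halfspace on the differences `xᵢ - xⱼ`. -/
theorem card_slab_traces_le {d : ℕ} (V : Set (EuclideanSpace ℝ (Fin d))) {ι : Type*} [Fintype ι]
    (x : ι → EuclideanSpace ℝ (Fin d)) :
    {p : Set ι | ∃ v ∈ V, ∃ a b : ℝ, p = {i | x i ∈ slab v a b}}.ncard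
      ≤ (Fintype.card ι ^ 2 + 1) ^ ((VC V).toNat + 1) := by
  classical
  set 𝒲 : Set (Finset (ι × ι)) :=
    {W | ∃ S ∈ halfspaces V, ∀ k, k ∈ W ↔ (fun k : ι × ι => x k.1 - x k.2) k ∈ S}
  have h𝒲 : 𝒲.ncard ≤ (Fintype.card ι ^ 2 + 1) ^ (VC V).toNat := by
    have := card_traces_le (halfspaces V) (fun k : ι × ι => x k.1 - x k.2)
      (m := (VC V).toNat) (by rw [ENat.natCast_toNat (VC_lt_top V).ne]; exact le_rfl)
    rwa [Fintype.card_prod, ← sq] at this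
  -- Recovers a trace from the order relation `w.1` and the indices `w.2` of its lowest and highest
  -- points; only the empty trace has none.
  let g : Finset (ι × ι) × (ι × ι) → Set ι := fun w => {i | (w.2.1, i) ∈ w.1 ∧ (i, w.2.2) ∈ w.1}
  have hsub : {p : Set ι | ∃ v ∈ V, ∃ a b : ℝ, p = {i | x i ∈ slab v a b}}
      ⊆ insert ∅ (g '' (𝒲 ×ˢ Set.univ)) := by
    rintro p ⟨v, hv, a, b, rfl⟩
    rcases Set.eq_empty_or_nonempty {i | x i ∈ slab v a b} with h | h
    · exact Or.inl h
    · right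
      obtain ⟨i₀, hi₀, hmin⟩ := Set.exists_min_image _ (fun i => inner ℝ v (x i))
        (Set.toFinite _) h
      obtain ⟨i₁, hi₁, hmax⟩ := Set.exists_max_image _ (fun i => inner ℝ v (x i))
        (Set.toFinite _) h
      refine ⟨(Finset.univ.filter fun k : ι × ι => inner ℝ v (x k.1 - x k.2) ≤ 0, (i₀, i₁)),
        ⟨⟨_, ⟨v, hv, rfl⟩, by simp⟩, trivial⟩, ?_⟩
      ext i
      simp only [g, Set.mem_ofPred_eq, Finset.mem_filter, Finset.mem_univ, true_and, inner_sub_right,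
        sub_nonpos]
      exact ⟨fun hi => ⟨hi₀.1.trans hi.1, hi.2.trans hi₁.2⟩, fun hi => ⟨hmin i hi, hmax i hi⟩⟩
  calc _ ≤ (insert ∅ (g '' (𝒲 ×ˢ Set.univ))).ncard := Set.ncard_le_ncard hsub (Set.toFinite _)
    _ ≤ (g '' (𝒲 ×ˢ Set.univ)).ncard + 1 := Set.ncard_insert_le _ _
    _ ≤ (𝒲 ×ˢ (Set.univ : Set (ι × ι))).ncard + 1 := by
        gcongr; exact Set.ncard_image_le (Set.toFinite _)
    _ = 𝒲.ncard * Fintype.card ι ^ 2 + 1 := by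
        rw [Set.ncard_prod, Set.ncard_univ, Nat.card_eq_fintype_card, Fintype.card_prod, ← sq]
    _ ≤ (Fintype.card ι ^ 2 + 1) ^ (VC V).toNat * Fintype.card ι ^ 2
          + (Fintype.card ι ^ 2 + 1) ^ (VC V).toNat := by
        gcongr; exact Nat.one_le_pow _ _ (Nat.succ_pos _)
    _ = _ := by ring

/-! ### Hoeffding's inequality for random swaps -/

/-- The sign attached to the decision to swap (`true`) or not (`false`) a pair. -/
def swapSign (b : Bool) : ℝ := if b then -1 else 1

/-- The sum over sign patterns factorizes, and each factor is bounded by cosh x ≤ exp (x² / 2). -/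
theorem sum_exp_swapSign_le {n : ℕ} (c : Fin n → ℝ) (s : ℝ) :
    ∑ σ : Fin n → Bool, Real.exp (s * ∑ i, swapSign (σ i) * c i)
      ≤ 2 ^ n * Real.exp (s ^ 2 * (∑ i, c i ^ 2) / 2) := by
  have h1 : ∀ σ : Fin n → Bool, Real.exp (s * ∑ i, swapSign (σ i) * c i)
      = ∏ i, Real.exp (s * (swapSign (σ i) * c i)) := fun σ => by
    rw [Finset.mul_sum, Real.exp_sum]
  have h2 : ∀ i, ∑ b : Bool, Real.exp (s * (swapSign b * c i))
      ≤ 2 * Real.exp ((s * c i) ^ 2 / 2) := fun i => by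
    have := Real.cosh_le_exp_half_sq (s * c i)
    rw [Real.cosh_eq] at this
    simp only [Fintype.sum_bool, swapSign, if_true, Bool.false_eq_true, if_false, one_mul,
      neg_one_mul, mul_neg]
    linarith
  simp_rw [h1]
  rw [← Fintype.piFinset_univ, ← Finset.prod_univ_sum (fun _ => Finset.univ)
    (fun i b => Real.exp (s * (swapSign b * c i)))]
  refine (Finset.prod_le_prod (fun i _ => Finset.sum_nonneg fun b _ => (Real.exp_pos _).le)
    (fun i _ => h2 i)).trans (le_of_eq ?_)
  rw [Finset.prod_mul_distrib, Finset.prod_const, Finset.card_univ, Fintype.card_fin,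
    ← Real.exp_sum, Finset.mul_sum, Finset.sum_div]
  simp_rw [mul_pow]

/-- Hoeffding's inequality for the random swaps of pairs, as a count. -/
theorem card_swap_deviation_le {n : ℕ} (c : Fin n → ℝ) {w r : ℝ} (hw : ∑ i, c i ^ 2 ≤ w)
    (hr : 0 ≤ r) :
    ({σ : Fin n → Bool | r ^ 2 * w < (∑ i, swapSign (σ i) * c i) ^ 2}.ncard : ℝ)
      ≤ 2 ^ n * (2 * Real.exp (-(r ^ 2 / 2))) := by
  classical
  have hc0 : 0 ≤ ∑ i, c i ^ 2 := Finset.sum_nonneg fun i _ => sq_nonneg _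
  rcases (hc0.trans hw).eq_or_lt with h0 | hpos
  · have hci : ∀ i, c i = 0 := by
      intro i
      have h := (Finset.sum_eq_zero_iff_of_nonneg (fun i _ => sq_nonneg (c i))).1
        (le_antisymm (hw.trans h0.ge) hc0) i (Finset.mem_univ i)
      exact pow_eq_zero_iff (two_ne_zero) |>.1 h
    simp only [hci, ← h0, mul_zero, Finset.sum_const_zero]
    simp
    positivity
  -- The optimal Chernoff parameter: s r √w - s² w / 2 = r² / 2.
  set s := r / Real.sqrt w
  have hsw : 0 < Real.sqrt w := Real.sqrt_pos.2 hpos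
  have hs0 : 0 ≤ s := div_nonneg hr hsw.le
  have hss : s * Real.sqrt w = r := div_mul_cancel₀ _ hsw.ne'
  have hs2 : s ^ 2 * w = r ^ 2 := by rw [← hss, mul_pow, Real.sq_sqrt hpos.le]
  have hexp : ∀ u : ℝ, u ^ 2 = s ^ 2 → ∑ σ : Fin n → Bool,
      Real.exp (u * ∑ i, swapSign (σ i) * c i) ≤ 2 ^ n * Real.exp (r ^ 2 / 2) := by
    intro u hu
    refine (sum_exp_swapSign_le c u).trans ?_
    rw [hu, ← hs2]
    gcongr
  have hmark : ∀ σ : Fin n → Bool,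
      (if r ^ 2 * w < (∑ i, swapSign (σ i) * c i) ^ 2 then (1 : ℝ) else 0)
      ≤ Real.exp (-r ^ 2) * (Real.exp (s * ∑ i, swapSign (σ i) * c i)
        + Real.exp (-s * ∑ i, swapSign (σ i) * c i)) := by
    intro σ
    split_ifs with h
    · have h1 : r * Real.sqrt w < |∑ i, swapSign (σ i) * c i| := by
        refine lt_of_pow_lt_pow_left₀ 2 (abs_nonneg _) ?_
        rwa [mul_pow, Real.sq_sqrt hpos.le, sq_abs]
      have h2 : r ^ 2 ≤ |s * ∑ i, swapSign (σ i) * c i| := by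
        rw [abs_mul, abs_of_nonneg hs0]
        calc r ^ 2 = s * (r * Real.sqrt w) := by rw [← hss]; ring
          _ ≤ _ := by gcongr
      have h3 : Real.exp (r ^ 2) ≤ Real.exp (s * ∑ i, swapSign (σ i) * c i)
          + Real.exp (-s * ∑ i, swapSign (σ i) * c i) := by
        rw [neg_mul]
        rcases le_abs.1 h2 with h | h
        · exact (Real.exp_le_exp.2 h).trans (le_add_of_nonneg_right (Real.exp_pos _).le)
        · exact (Real.exp_le_exp.2 h).trans (le_add_of_nonneg_left (Real.exp_pos _).le)
      calc (1 : ℝ) = Real.exp (-r ^ 2) * Real.exp (r ^ 2) := by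
            rw [← Real.exp_add, neg_add_cancel, Real.exp_zero]
        _ ≤ _ := by gcongr
    · positivity
  have hcard : ({σ : Fin n → Bool | r ^ 2 * w < (∑ i, swapSign (σ i) * c i) ^ 2}.ncard : ℝ)
      = ∑ σ : Fin n → Bool,
        if r ^ 2 * w < (∑ i, swapSign (σ i) * c i) ^ 2 then (1 : ℝ) else 0 := by
    rw [Set.ncard_eq_toFinset_card', Finset.sum_boole]
    congr 2
    ext σ
    simp
  rw [hcard]
  calc _ ≤ ∑ σ : Fin n → Bool, Real.exp (-r ^ 2) * (Real.exp (s * ∑ i, swapSign (σ i) * c i)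
        + Real.exp (-s * ∑ i, swapSign (σ i) * c i)) := Finset.sum_le_sum fun σ _ => hmark σ
    _ ≤ Real.exp (-r ^ 2) * (2 ^ n * Real.exp (r ^ 2 / 2) + 2 ^ n * Real.exp (r ^ 2 / 2)) := by
        rw [← Finset.mul_sum, Finset.sum_add_distrib]
        gcongr
        · exact hexp s rfl
        · exact hexp (-s) (by ring)
    _ = 2 ^ n * (2 * (Real.exp (-r ^ 2) * Real.exp (r ^ 2 / 2))) := by ring
    _ = _ := by rw [← Real.exp_add]; ring_nf

/-! ### Ghost sample and symmetrization -/

/-- A count `k` that is close to a ghost count `k'`, itself close to its mean `m`, is close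
to `m`. -/
theorem abs_sub_le_of_ghost {k k' m r : ℝ} (hk : 0 ≤ k) (hr : 1 ≤ r)
    (hkk' : (k - k') ^ 2 ≤ r ^ 2 * (k + k')) (hm : (m - k') ^ 2 ≤ 2 * m + 1) :
    |m - k| ≤ 5 * r * (Real.sqrt k + r) := by
  obtain ⟨a, ha, rfl⟩ : ∃ a : ℝ, 0 ≤ a ∧ k = a ^ 2 :=
    ⟨Real.sqrt k, Real.sqrt_nonneg _, (Real.sq_sqrt hk).symm⟩
  rw [Real.sqrt_sq ha]
  -- For D = |k - k'|, the hypothesis gives D (D - r²) ≤ 2 a² r², while D > r (2a + r) would force D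
  -- (D - r²) ≥ 2 a r D ≥ 4 a² r² + 2 a r³.
  have h1 : |a ^ 2 - k'| ≤ r * (2 * a + r) := by
    by_contra! h
    set D := |a ^ 2 - k'| with hD
    have hk'D : k' ≤ a ^ 2 + D := by have := neg_abs_le (a ^ 2 - k'); linarith
    have hD2 : D ^ 2 ≤ r ^ 2 * (2 * a ^ 2 + D) := by
      rw [hD, sq_abs, ← hD]
      exact hkk'.trans (mul_le_mul_of_nonneg_left (by linarith) (sq_nonneg r))
    have har : 0 ≤ r * (2 * a) := by positivity
    have h3 : D * (r * (2 * a)) ≤ D * (D - r ^ 2) := by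
      apply mul_le_mul_of_nonneg_left _ (abs_nonneg _); nlinarith
    have h4 : (r * (2 * a + r)) * (r * (2 * a)) ≤ D * (r * (2 * a)) := by gcongr
    rcases ha.eq_or_lt with rfl | hapos
    · have hDr : r ^ 2 < D := by nlinarith
      nlinarith
    · have : 0 < r ^ 2 * a ^ 2 := by positivity
      have : 0 < r ^ 3 * a := by positivity
      nlinarith
  have hk' : k' ≤ (a + r) ^ 2 := by
    have := neg_abs_le (a ^ 2 - k'); nlinarith
  -- Substituting m ≤ k' + u into u² ≤ 2m + 1 and completing the square gives (u - 1)² ≤ 2k' + 2.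
  have h2 : |m - k'| ≤ 3 / 2 * a + 4 * r := by
    by_contra! h
    set u := |m - k'| with hu
    have hmu : m ≤ k' + u := by have := le_abs_self (m - k'); linarith
    have hu2 : u ^ 2 ≤ 2 * m + 1 := by rw [hu, sq_abs]; exact hm
    have h3 : (u - 1) ^ 2 ≤ 2 * (a + r) ^ 2 + 2 := by nlinarith
    have h4 : (3 / 2 * a + 3 * r) ^ 2 < (u - 1) ^ 2 := by
      apply pow_lt_pow_left₀ _ (by positivity) two_ne_zero
      linarith
    nlinarith [mul_nonneg ha (zero_le_one.trans hr)]
  calc |m - a ^ 2| ≤ |m - k'| + |k' - a ^ 2| := abs_sub_le _ _ _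
    _ ≤ (3 / 2 * a + 4 * r) + r * (2 * a + r) := by
        rw [abs_sub_comm k']; gcongr
    _ ≤ _ := by nlinarith [mul_nonneg ha (sub_nonneg.2 hr), mul_nonneg (zero_le_one.trans hr) (sub_nonneg.2 hr)]

/-- The number of indices `i` with `z i ∈ B`. -/
noncomputable def hitCount {Z : Type*} {n : ℕ} (B : Set Z) (z : Fin n → Z) : ℝ :=
  ∑ i, B.indicator (fun _ => 1) (z i)

section Count

variable {Z : Type*} {n : ℕ}

theorem hitCount_nonneg (B : Set Z) (z : Fin n → Z) : 0 ≤ hitCount B z :=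
  Finset.sum_nonneg fun _ _ => Set.indicator_nonneg (fun _ _ => zero_le_one) _

theorem hitCount_mono {B B' : Set Z} (h : B ⊆ B') (z : Fin n → Z) :
    hitCount B z ≤ hitCount B' z :=
  Finset.sum_le_sum fun _ _ => Set.indicator_le_indicator_of_subset h (fun _ => zero_le_one) _

variable [MeasurableSpace Z]

theorem measurable_hitCount {B : Set Z} (hB : MeasurableSet B) :
    Measurable (hitCount B : (Fin n → Z) → ℝ) :=
  Finset.measurable_sum _ fun i _ =>
    (measurable_const.indicator hB).comp (measurable_pi_apply i)

variable (P : Measure Z) [IsProbabilityMeasure P]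

/-- Chebyshev's inequality for the number of sample points in `B`. -/
theorem half_le_measure_hitCount_near {B : Set Z} (hB : MeasurableSet B) :
    (1 / 2 : ENNReal) ≤ Measure.pi (fun _ : Fin n => P)
      {z | (n * P.real B - hitCount B z) ^ 2 ≤ 2 * (n * P.real B) + 1} := by
  set X : Z → ℝ := B.indicator fun _ => (1 : ℝ)
  have hX : MemLp X 2 P := memLp_indicator_const 2 hB 1 (Or.inr (measure_ne_top _ _))
  have hXint : ∫ z, X z ∂P = P.real B := by
    simp only [X]; rw [integral_indicator_const _ hB]; simp
  have hcount : (hitCount B : (Fin n → Z) → ℝ) = ∑ i : Fin n, fun z : Fin n → Z => X (z i) := by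
    funext z; simp [X, hitCount]
  have hmem : ∀ i : Fin n, MemLp (fun z : Fin n → Z => X (z i)) 2 (Measure.pi fun _ => P) :=
    fun i => hX.comp_measurePreserving (measurePreserving_eval (fun _ : Fin n => P) i)
  have hmean : ∫ z, hitCount B z ∂(Measure.pi fun _ : Fin n => P) = n * P.real B := by
    have : ∀ i : Fin n, ∫ z : Fin n → Z, X (z i) ∂(Measure.pi fun _ => P) = P.real B := by
      intro i
      have hmap := integral_map (μ := Measure.pi fun _ : Fin n => P) (f := X)
        (measurable_pi_apply i).aemeasurable (measurable_const.indicator hB).aestronglyMeasurable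
      rw [← hmap, ← hXint]
      exact congrArg (fun Q => ∫ z, X z ∂Q) (measurePreserving_eval (fun _ : Fin n => P) i).map_eq
    simp_rw [hitCount]
    rw [integral_finsetSum _ fun i _ => (hmem i).integrable (by norm_num)]
    change ∑ i : Fin n, ∫ z : Fin n → Z, X (z i) ∂(Measure.pi fun _ => P) = _
    simp [this]
  have hvar : Var[hitCount B; Measure.pi fun _ : Fin n => P] ≤ n * P.real B := by
    rw [hcount, variance_sum_pi fun _ => hX]
    have : Var[X; P] ≤ P.real B := by
      refine (variance_le_expectation_sq hX.aestronglyMeasurable).trans (le_of_eq ?_)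
      rw [← hXint]
      congr 1
      funext z
      by_cases hz : z ∈ B <;> simp [X, hz]
    simpa using mul_le_mul_of_nonneg_left this (Nat.cast_nonneg n)
  have hm0 : 0 ≤ n * P.real B := by positivity
  -- The summand 1 keeps the Chebyshev threshold positive when `B` is null.
  have hcpos : 0 < Real.sqrt (2 * (n * P.real B) + 1) := Real.sqrt_pos.2 (by positivity)
  have hmemc : MemLp (hitCount B) 2 (Measure.pi fun _ : Fin n => P) := by
    rw [hcount]; exact memLp_finsetSum' _ fun i _ => hmem i
  have hcheb := meas_ge_le_variance_div_sq hmemc hcpos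
  rw [hmean, Real.sq_sqrt (by positivity)] at hcheb
  have hbad : Measure.pi (fun _ : Fin n => P)
      {z | (n * P.real B - hitCount B z) ^ 2 ≤ 2 * (n * P.real B) + 1}ᶜ ≤ 1 / 2 := by
    refine (measure_mono fun z hz => ?_).trans (hcheb.trans ?_)
    · have hz' : 2 * (n * P.real B) + 1 < (n * P.real B - hitCount B z) ^ 2 := not_le.1 hz
      refine (Real.sqrt_le_sqrt hz'.le).trans ?_
      rw [Real.sqrt_sq_eq_abs, abs_sub_comm]
    · rw [show (1 / 2 : ENNReal) = ENNReal.ofReal (1 / 2) by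
        rw [ENNReal.ofReal_div_of_pos two_pos]; simp]
      refine ENNReal.ofReal_le_ofReal ?_
      rw [div_le_div_iff₀ (by positivity) two_pos]
      linarith
  have hmeas : MeasurableSet
      {z : Fin n → Z | (n * P.real B - hitCount B z) ^ 2 ≤ 2 * (n * P.real B) + 1} :=
    measurableSet_le ((measurable_const.sub (measurable_hitCount hB)).pow_const 2) measurable_const
  rw [measure_compl hmeas (measure_ne_top _ _), measure_univ] at hbad
  have h2 : (1 : ENNReal) - 1 / 2 = 1 / 2 := by
    rw [one_div, ENNReal.one_sub_inv_two]
  rw [← h2]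
  exact tsub_le_iff_tsub_le.1 hbad

/-- Swap the components of the pairs selected by `σ`. -/
def swapPairs (σ : Fin n → Bool) (z : Fin n → Z × Z) : Fin n → Z × Z :=
  fun i => if σ i then (z i).swap else z i

/-- This exchangeability lets the probability of a bad event be averaged over all swaps. -/
theorem measurePreserving_swapPairs (σ : Fin n → Bool) :
    MeasurePreserving (swapPairs σ) (Measure.pi fun _ : Fin n => P.prod P)
      (Measure.pi fun _ : Fin n => P.prod P) := by
  refine measurePreserving_pi (fun _ : Fin n => P.prod P) (fun _ => P.prod P)
    (f := fun i w => if σ i then w.swap else w) fun i => ?_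
  cases h : σ i
  · exact MeasurePreserving.id _
  · simpa using Measure.measurePreserving_swap

/-- The ghost sample bound: a self-normalized deviation between the two halves of a double sample
is unlikely for a countable family of sets with few traces. -/
theorem measure_ghost_deviation_le {κ : Type*} [Countable κ] (B : κ → Set Z)
    (hB : ∀ i, MeasurableSet (B i)) {N : ℕ}
    (hN : ∀ y : Fin n ⊕ Fin n → Z, {p : Set (Fin n ⊕ Fin n) | ∃ i, p = {u | y u ∈ B i}}.ncard ≤ N)
    {r : ℝ} (hr : 0 ≤ r) :
    Measure.pi (fun _ : Fin n => P.prod P) {z | ∃ i,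
        r ^ 2 * (hitCount (B i) (fun j => (z j).1) + hitCount (B i) (fun j => (z j).2))
          < (hitCount (B i) (fun j => (z j).1) - hitCount (B i) (fun j => (z j).2)) ^ 2}
      ≤ ENNReal.ofReal (N * (2 * Real.exp (-(r ^ 2 / 2)))) := by
  classical
  set E : Set (Fin n → Z × Z) := {z | ∃ i,
        r ^ 2 * (hitCount (B i) (fun j => (z j).1) + hitCount (B i) (fun j => (z j).2))
          < (hitCount (B i) (fun j => (z j).1) - hitCount (B i) (fun j => (z j).2)) ^ 2} with hE
  have hEm : MeasurableSet E := by
    rw [hE, Set.ofPred_exists]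
    refine MeasurableSet.iUnion fun i => ?_
    have h1 : Measurable fun z : Fin n → Z × Z => hitCount (B i) (fun j => (z j).1) :=
      (measurable_hitCount (hB i)).comp (by fun_prop)
    have h2 : Measurable fun z : Fin n → Z × Z => hitCount (B i) (fun j => (z j).2) :=
      (measurable_hitCount (hB i)).comp (by fun_prop)
    exact measurableSet_lt ((h1.add h2).const_mul _) ((h1.sub h2).pow_const 2)
  -- With the double sample fixed, swaps preserve the sum of the two counts and only change signs in
  -- their difference; Hoeffding is applied once per trace.
  have hcount : ∀ z, ({σ : Fin n → Bool | swapPairs σ z ∈ E}.ncard : ℝ)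
      ≤ 2 ^ n * (N * (2 * Real.exp (-(r ^ 2 / 2)))) := by
    intro z
    let y : Fin n ⊕ Fin n → Z := Sum.elim (fun j => (z j).1) (fun j => (z j).2)
    let Tr : Finset (Set (Fin n ⊕ Fin n)) :=
      (Set.toFinite {p : Set (Fin n ⊕ Fin n) | ∃ i, p = {u | y u ∈ B i}}).toFinset
    have hTr : Tr.card ≤ N := by
      rw [← Set.ncard_eq_toFinset_card]; exact hN y
    let L : Set (Fin n ⊕ Fin n) → Fin n → ℝ := fun p j => p.indicator (fun _ => 1) (Sum.inl j)
    let R : Set (Fin n ⊕ Fin n) → Fin n → ℝ := fun p j => p.indicator (fun _ => 1) (Sum.inr j)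
    have hsub : {σ : Fin n → Bool | swapPairs σ z ∈ E} ⊆ ⋃ p ∈ Tr, {σ : Fin n → Bool |
        r ^ 2 * (∑ j, (L p j + R p j)) < (∑ j, swapSign (σ j) * (L p j - R p j)) ^ 2} := by
      rintro σ ⟨i, hi⟩
      refine Set.mem_iUnion₂.2 ⟨{u | y u ∈ B i}, ?_, ?_⟩
      · exact (Set.Finite.mem_toFinset _).2 ⟨i, rfl⟩
      · have hL : ∀ j, L {u | y u ∈ B i} j = (B i).indicator (fun _ => 1) (z j).1 := fun _ => rfl
        have hR : ∀ j, R {u | y u ∈ B i} j = (B i).indicator (fun _ => 1) (z j).2 := fun _ => rfl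
        have hadd : hitCount (B i) (fun j => (swapPairs σ z j).1)
            + hitCount (B i) (fun j => (swapPairs σ z j).2)
            = ∑ j, (L {u | y u ∈ B i} j + R {u | y u ∈ B i} j) := by
          rw [hitCount, hitCount, ← Finset.sum_add_distrib]
          refine Finset.sum_congr rfl fun j _ => ?_
          rw [hL j, hR j]
          cases h : σ j <;> simp [swapPairs, h, add_comm]
        have hsub : hitCount (B i) (fun j => (swapPairs σ z j).1)
            - hitCount (B i) (fun j => (swapPairs σ z j).2)
            = ∑ j, swapSign (σ j) * (L {u | y u ∈ B i} j - R {u | y u ∈ B i} j) := by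
          rw [hitCount, hitCount, ← Finset.sum_sub_distrib]
          refine Finset.sum_congr rfl fun j _ => ?_
          rw [hL j, hR j]
          cases h : σ j <;> simp [swapPairs, h, swapSign]
        rw [hadd, hsub] at hi
        exact hi
    have hbound : ∀ p ∈ Tr, ({σ : Fin n → Bool |
        r ^ 2 * (∑ j, (L p j + R p j)) < (∑ j, swapSign (σ j) * (L p j - R p j)) ^ 2}.ncard : ℝ)
        ≤ 2 ^ n * (2 * Real.exp (-(r ^ 2 / 2))) := by
      intro p _
      -- For values in {0, 1}, (L - R)² ≤ L + R: this is what makes the bound self-normalized.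
      refine card_swap_deviation_le _ (Finset.sum_le_sum fun j _ => ?_) hr
      simp only [L, R, Set.indicator]
      split_ifs <;> norm_num
    calc _ ≤ ((⋃ p ∈ Tr, {σ : Fin n → Bool |
          r ^ 2 * (∑ j, (L p j + R p j))
            < (∑ j, swapSign (σ j) * (L p j - R p j)) ^ 2}).ncard : ℝ) := by
          exact_mod_cast Set.ncard_le_ncard hsub (Set.toFinite _)
      _ ≤ ∑ p ∈ Tr, ({σ : Fin n → Bool | r ^ 2 * (∑ j, (L p j + R p j))
            < (∑ j, swapSign (σ j) * (L p j - R p j)) ^ 2}.ncard : ℝ) := by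
          exact_mod_cast Finset.set_ncard_biUnion_le _ _
      _ ≤ Tr.card * (2 ^ n * (2 * Real.exp (-(r ^ 2 / 2)))) := by
          rw [← nsmul_eq_mul]; exact Finset.sum_le_card_nsmul _ _ _ hbound
      _ ≤ N * (2 ^ n * (2 * Real.exp (-(r ^ 2 / 2)))) := by gcongr
      _ = _ := by ring
  have havg : (2 ^ n : ENNReal) * Measure.pi (fun _ : Fin n => P.prod P) E
      ≤ 2 ^ n * ENNReal.ofReal (N * (2 * Real.exp (-(r ^ 2 / 2)))) := by
    calc (2 ^ n : ENNReal) * Measure.pi (fun _ : Fin n => P.prod P) E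
        = ∑ σ : Fin n → Bool, Measure.pi (fun _ : Fin n => P.prod P) (swapPairs σ ⁻¹' E) := by
          simp_rw [fun σ => (measurePreserving_swapPairs P σ).measure_preimage
            hEm.nullMeasurableSet]
          simp
      _ = ∑ σ : Fin n → Bool, ∫⁻ z, (swapPairs σ ⁻¹' E).indicator 1 z
            ∂(Measure.pi fun _ : Fin n => P.prod P) := by
          refine Finset.sum_congr rfl fun σ _ => ?_
          rw [lintegral_indicator_one ((measurePreserving_swapPairs P σ).measurable hEm)]
      _ = ∫⁻ z, ∑ σ : Fin n → Bool, (swapPairs σ ⁻¹' E).indicator 1 z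
            ∂(Measure.pi fun _ : Fin n => P.prod P) := by
          rw [lintegral_finsetSum]
          exact fun σ _ => measurable_one.indicator
            ((measurePreserving_swapPairs P σ).measurable hEm)
      _ ≤ ∫⁻ _, ENNReal.ofReal (2 ^ n * (N * (2 * Real.exp (-(r ^ 2 / 2)))))
            ∂(Measure.pi fun _ : Fin n => P.prod P) := by
          refine lintegral_mono fun z => ?_
          refine le_trans (le_of_eq ?_) (ENNReal.ofReal_le_ofReal (hcount z))
          rw [ENNReal.ofReal_natCast, Set.ncard_eq_toFinset_card']
          simp [Set.indicator_apply]
      _ = _ := by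
          rw [lintegral_const, measure_univ, mul_one, ENNReal.ofReal_mul (by positivity),
            ENNReal.ofReal_pow zero_le_two, ENNReal.ofReal_ofNat]
  exact (ENNReal.mul_le_mul_iff_right (by positivity) (by finiteness)).1 havg

/-- Relative deviations of empirical counts, uniformly over a countable family of sets with few
traces. -/
theorem measure_deviation_le {κ : Type*} [Countable κ] (B : κ → Set Z)
    (hB : ∀ i, MeasurableSet (B i)) {N : ℕ}
    (hN : ∀ y : Fin n ⊕ Fin n → Z, {p : Set (Fin n ⊕ Fin n) | ∃ i, p = {u | y u ∈ B i}}.ncard ≤ N)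
    {r : ℝ} (hr : 1 ≤ r) :
    Measure.pi (fun _ : Fin n => P) {z | ∃ i,
        5 * r * (Real.sqrt (hitCount (B i) z) + r) < |n * P.real (B i) - hitCount (B i) z|}
      ≤ ENNReal.ofReal (N * (4 * Real.exp (-(r ^ 2 / 2)))) := by
  set A : Set (Fin n → Z) := {z | ∃ i,
        5 * r * (Real.sqrt (hitCount (B i) z) + r) < |n * P.real (B i) - hitCount (B i) z|} with hA
  let E : Set ((Fin n → Z) × (Fin n → Z)) := {z | ∃ i,
        r ^ 2 * (hitCount (B i) z.1 + hitCount (B i) z.2)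
          < (hitCount (B i) z.1 - hitCount (B i) z.2) ^ 2}
  have hEm : MeasurableSet E := by
    simp only [E]
    rw [Set.ofPred_exists]
    refine MeasurableSet.iUnion fun i => ?_
    have h1 : Measurable fun z : (Fin n → Z) × (Fin n → Z) => hitCount (B i) z.1 :=
      (measurable_hitCount (hB i)).comp measurable_fst
    have h2 : Measurable fun z : (Fin n → Z) × (Fin n → Z) => hitCount (B i) z.2 :=
      (measurable_hitCount (hB i)).comp measurable_snd
    exact measurableSet_lt ((h1.add h2).const_mul _) ((h1.sub h2).pow_const 2)
  have hAm : MeasurableSet A := by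
    rw [hA, Set.ofPred_exists]
    refine MeasurableSet.iUnion fun i => ?_
    have h1 : Measurable (hitCount (B i) : (Fin n → Z) → ℝ) := measurable_hitCount (hB i)
    have h2 : Measurable fun z : Fin n → Z => |n * P.real (B i) - hitCount (B i) z| :=
      (measurable_const.sub h1).norm
    exact measurableSet_lt ((h1.sqrt.add_const r).const_mul _) h2
  have hghost : ((Measure.pi fun _ : Fin n => P).prod (Measure.pi fun _ : Fin n => P)) E
      ≤ ENNReal.ofReal (N * (2 * Real.exp (-(r ^ 2 / 2)))) := by
    have hmp := measurePreserving_arrowProdEquivProdArrow Z Z (Fin n) (fun _ => P) (fun _ => P)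
    rw [← hmp.measure_preimage hEm.nullMeasurableSet]
    exact measure_ghost_deviation_le P B hB hN (zero_le_one.trans hr)
  -- For a bad sample, every ghost sample within the Chebyshev range gives a bad pair. Hence passing
  -- to pairs costs a factor 2.
  have hsection : ∀ z ∈ A, (1 / 2 : ENNReal) ≤
      Measure.pi (fun _ : Fin n => P) (Prod.mk z ⁻¹' E) := by
    rintro z ⟨i, hi⟩
    refine (half_le_measure_hitCount_near P (hB i)).trans (measure_mono fun z' hz' => ?_)
    refine ⟨i, ?_⟩
    by_contra! h
    exact absurd (abs_sub_le_of_ghost (hitCount_nonneg _ _) hr h hz') (not_le.2 hi)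
  have hhalf : Measure.pi (fun _ : Fin n => P) A * (1 / 2)
      ≤ ENNReal.ofReal (N * (2 * Real.exp (-(r ^ 2 / 2)))) := by
    refine le_trans ?_ hghost
    rw [Measure.prod_apply hEm, mul_comm]
    calc (1 / 2 : ENNReal) * Measure.pi (fun _ : Fin n => P) A
        = ∫⁻ _ in A, (1 / 2 : ENNReal) ∂(Measure.pi fun _ : Fin n => P) := by
          rw [setLIntegral_const]
      _ ≤ ∫⁻ z in A, Measure.pi (fun _ : Fin n => P) (Prod.mk z ⁻¹' E)
            ∂(Measure.pi fun _ : Fin n => P) := setLIntegral_mono' hAm hsection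
      _ ≤ _ := setLIntegral_le_lintegral _ _
  calc Measure.pi (fun _ : Fin n => P) A
      = Measure.pi (fun _ : Fin n => P) A * (1 / 2) * 2 := by
        rw [mul_assoc, one_div, ENNReal.inv_mul_cancel two_ne_zero (by norm_num), mul_one]
    _ ≤ ENNReal.ofReal (N * (2 * Real.exp (-(r ^ 2 / 2)))) * ENNReal.ofReal 2 := by
        rw [ENNReal.ofReal_ofNat]; gcongr
    _ = _ := by rw [← ENNReal.ofReal_mul (by positivity)]; ring_nf

end Count

/-! ### Freezing the random confidence set -/

/-- Relative deviations for a countable family of random sets with few traces that is independent of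
the sample. -/
theorem measure_section_deviation_le {Z Θ Ω κ : Type*} [MeasurableSpace Z] [MeasurableSpace Θ]
    [MeasurableSpace Ω] [Countable κ] {n : ℕ} (P : Measure Z) [IsProbabilityMeasure P]
    (μ : Measure Ω) [IsProbabilityMeasure μ] {X : Fin n → Ω → Z} (hX : ∀ i, Measurable (X i))
    (hlaw : ∀ i, μ.map (X i) = P) (hind : iIndepFun X μ) {T : Ω → Θ} (hT : Measurable T)
    (hTX : IndepFun T (fun ω i => X i ω) μ) (G : κ → Set (Θ × Z)) (hG : ∀ i, MeasurableSet (G i))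
    {N : ℕ} (hN : ∀ (θ : Θ) (y : Fin n ⊕ Fin n → Z),
      {p : Set (Fin n ⊕ Fin n) | ∃ i, p = {u | (θ, y u) ∈ G i}}.ncard ≤ N) {r : ℝ} (hr : 1 ≤ r) :
    μ {ω | ∃ i, 5 * r * (Real.sqrt (hitCount (Prod.mk (T ω) ⁻¹' G i) fun j => X j ω) + r)
        < |n * P.real (Prod.mk (T ω) ⁻¹' G i) - hitCount (Prod.mk (T ω) ⁻¹' G i) fun j => X j ω|}
      ≤ ENNReal.ofReal (N * (4 * Real.exp (-(r ^ 2 / 2)))) := by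
  let D : Set (Θ × (Fin n → Z)) := {w | ∃ i,
    5 * r * (Real.sqrt (hitCount (Prod.mk w.1 ⁻¹' G i) w.2) + r)
      < |n * P.real (Prod.mk w.1 ⁻¹' G i) - hitCount (Prod.mk w.1 ⁻¹' G i) w.2|}
  have hD : MeasurableSet D := by
    simp only [D]
    rw [Set.ofPred_exists]
    refine MeasurableSet.iUnion fun i => ?_
    have h1 : Measurable fun w : Θ × (Fin n → Z) => hitCount (Prod.mk w.1 ⁻¹' G i) w.2 := by
      refine Finset.measurable_sum _ fun j _ => ?_
      change Measurable fun w : Θ × (Fin n → Z) =>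
        (G i).indicator (fun _ => (1 : ℝ)) (w.1, w.2 j)
      exact (measurable_const.indicator (hG i)).comp (by fun_prop)
    have h2 : Measurable fun w : Θ × (Fin n → Z) => P.real (Prod.mk w.1 ⁻¹' G i) :=
      ((measurable_measure_prodMk_left (hG i)).ennreal_toReal).comp measurable_fst
    have h3 : Measurable fun w : Θ × (Fin n → Z) =>
        |n * P.real (Prod.mk w.1 ⁻¹' G i) - hitCount (Prod.mk w.1 ⁻¹' G i) w.2| :=
      ((h2.const_mul _).sub h1).norm
    exact measurableSet_lt ((h1.sqrt.add_const r).const_mul _) h3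
  have hXm : Measurable fun ω i => X i ω := measurable_pi_lambda _ hX
  have hmapX : μ.map (fun ω i => X i ω) = Measure.pi fun _ => P := by
    rw [(iIndepFun_iff_map_fun_eq_pi_map fun i => (hX i).aemeasurable).1 hind]
    simp_rw [hlaw]
  have hjoint := (indepFun_iff_map_prod_eq_prod_map_map hT.aemeasurable hXm.aemeasurable).1 hTX
  have : IsProbabilityMeasure (μ.map T) := Measure.isProbabilityMeasure_map hT.aemeasurable
  calc _ = (μ.map fun ω => (T ω, fun i => X i ω)) D :=
        (Measure.map_apply (hT.prodMk hXm) hD).symm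
    _ = ∫⁻ θ, Measure.pi (fun _ : Fin n => P) (Prod.mk θ ⁻¹' D) ∂(μ.map T) := by
        rw [hjoint, hmapX, Measure.prod_apply hD]
    _ ≤ ∫⁻ _, ENNReal.ofReal (N * (4 * Real.exp (-(r ^ 2 / 2)))) ∂(μ.map T) :=
        lintegral_mono fun θ => measure_deviation_le P (fun i => Prod.mk θ ⁻¹' G i)
          (fun i => measurable_prodMk_left (hG i)) (hN θ) hr
    _ = _ := by simp

/-! ### Reduction to countably many slabs -/

theorem measurableSet_slab {d : ℕ} (v : EuclideanSpace ℝ (Fin d)) (a b : ℝ) :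
    MeasurableSet (slab v a b) := by
  have h : Measurable fun x : EuclideanSpace ℝ (Fin d) => (inner ℝ v x : ℝ) :=
    (continuous_const.inner continuous_id).measurable
  exact (measurableSet_le measurable_const h).inter (measurableSet_le h measurable_const)

/-- Every slab is a pointwise limit of slabs with rational offsets and direction in a dense set. -/
theorem exists_slab_approx {d : ℕ} {V₀ : Set (EuclideanSpace ℝ (Fin d))}
    {v : EuclideanSpace ℝ (Fin d)} (hv : v ∈ closure V₀) (a b : ℝ) :
    ∃ (w : ℕ → EuclideanSpace ℝ (Fin d)) (α β : ℕ → ℚ), (∀ k, w k ∈ V₀) ∧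
      ∀ x, ∀ᶠ k in Filter.atTop, (x ∈ slab (w k) (α k) (β k) ↔ x ∈ slab v a b) := by
  have hpos : ∀ k : ℕ, (0 : ℝ) < 1 / (k + 1) := fun k => Nat.one_div_pos_of_nat
  -- With ε = 1 / (k + 1), directions within ε² of v change ⟪v, x⟫ by at most ε² ‖x‖ ≤ ε once k + 1
  -- ≥ ‖x‖. Offsets move outward by between ε and 2ε, so points of the closed slab stay inside, and
  -- a point at gap c stays outside once 3ε < c.
  choose w hwV hw using fun k : ℕ => Metric.mem_closure_iff.1 hv ((1 / (k + 1)) ^ 2)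
    (pow_pos (hpos k) 2)
  choose α hα using fun k : ℕ => exists_rat_btwn
    (show a - 2 * (1 / ((k : ℝ) + 1)) < a - 1 / (k + 1) by linarith [hpos k])
  choose β hβ using fun k : ℕ => exists_rat_btwn
    (show b + 1 / ((k : ℝ) + 1) < b + 2 * (1 / (k + 1)) by linarith [hpos k])
  refine ⟨w, α, β, hwV, fun x => ?_⟩
  have hinner : ∀ k : ℕ, |(inner ℝ (w k) x : ℝ) - inner ℝ v x| ≤ (1 / ((k : ℝ) + 1)) ^ 2 * ‖x‖ := by
    intro k
    rw [← inner_sub_left]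
    refine (abs_real_inner_le_norm _ _).trans ?_
    gcongr
    rw [← dist_eq_norm, dist_comm]
    exact (hw k).le
  have hlarge : ∀ᶠ k : ℕ in Filter.atTop, ‖x‖ ≤ (k : ℝ) + 1 := by
    filter_upwards [Filter.eventually_ge_atTop ⌈‖x‖⌉₊] with k hk
    have := (Nat.le_ceil ‖x‖).trans (Nat.cast_le.2 hk)
    linarith
  have hclose : ∀ᶠ k : ℕ in Filter.atTop,
      |(inner ℝ (w k) x : ℝ) - inner ℝ v x| ≤ 1 / ((k : ℝ) + 1) := by
    filter_upwards [hlarge] with k hk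
    calc _ ≤ (1 / ((k : ℝ) + 1)) ^ 2 * ‖x‖ := hinner k
      _ ≤ (1 / ((k : ℝ) + 1)) ^ 2 * (k + 1) := by gcongr
      _ = _ := by field_simp
  have hsmall : ∀ c : ℝ, 0 < c → ∀ᶠ k : ℕ in Filter.atTop, 3 * (1 / ((k : ℝ) + 1)) < c := by
    intro c hc
    filter_upwards [tendsto_one_div_add_atTop_nhds_zero_nat.eventually
      (gt_mem_nhds (show (0 : ℝ) < c / 3 by positivity))] with k hk
    linarith
  by_cases hx : x ∈ slab v a b
  · filter_upwards [hclose] with k hk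
    obtain ⟨h1, h2⟩ := abs_le.1 hk
    refine iff_of_true ⟨?_, ?_⟩ hx
    · linarith [(hα k).2, hx.1]
    · linarith [(hβ k).1, hx.2]
  · rcases not_and_or.1 hx with h | h
    · filter_upwards [hclose, hsmall _ (sub_pos.2 (not_le.1 h))] with k hk hs
      refine iff_of_false (fun hmem => ?_) hx
      linarith [hmem.1, (hα k).1, (abs_le.1 hk).2]
    · filter_upwards [hclose, hsmall _ (sub_pos.2 (not_le.1 h))] with k hk hs
      refine iff_of_false (fun hmem => ?_) hx
      linarith [hmem.2, (hβ k).2, (abs_le.1 hk).1]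

/-- A relative deviation bound for the slabs with rational offsets and direction in a dense set
passes to all slabs. -/
theorem slab_deviation_le_of_dense {d n : ℕ} {Y : Type*} [MeasurableSpace Y]
    (P : Measure (EuclideanSpace ℝ (Fin d) × Y)) [IsProbabilityMeasure P]
    {V₀ : Set (EuclideanSpace ℝ (Fin d))} {A : Set (EuclideanSpace ℝ (Fin d) × Y)}
    (hA : MeasurableSet A) (z : Fin n → EuclideanSpace ℝ (Fin d) × Y) {r : ℝ}
    (h : ∀ w ∈ V₀, ∀ α β : ℚ,
      |n * P.real ({z | z.1 ∈ slab w α β} ∩ A) - hitCount ({z | z.1 ∈ slab w α β} ∩ A) z|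
        ≤ 5 * r * (Real.sqrt (hitCount ({z | z.1 ∈ slab w α β} ∩ A) z) + r))
    {v : EuclideanSpace ℝ (Fin d)} (hv : v ∈ closure V₀) (a b : ℝ) :
    |n * P.real ({z | z.1 ∈ slab v a b} ∩ A) - hitCount ({z | z.1 ∈ slab v a b} ∩ A) z|
      ≤ 5 * r * (Real.sqrt (hitCount ({z | z.1 ∈ slab v a b} ∩ A) z) + r) := by
  obtain ⟨w, α, β, hw, hlim⟩ := exists_slab_approx hv a b
  have hiff : ∀ y : EuclideanSpace ℝ (Fin d) × Y, ∀ᶠ k in Filter.atTop,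
      (y ∈ {z : EuclideanSpace ℝ (Fin d) × Y | z.1 ∈ slab (w k) (α k) (β k)} ∩ A
        ↔ y ∈ {z : EuclideanSpace ℝ (Fin d) × Y | z.1 ∈ slab v a b} ∩ A) := fun y => by
    filter_upwards [hlim y.1] with k hk
    exact and_congr_left fun _ => hk
  -- Only finitely many sample points matter, so the counts are eventually equal; the masses merely
  -- converge.
  have hcount : ∀ᶠ k in Filter.atTop, hitCount ({z | z.1 ∈ slab (w k) (α k) (β k)} ∩ A) z
      = hitCount ({z | z.1 ∈ slab v a b} ∩ A) z := by
    filter_upwards [Filter.eventually_all.2 fun i => hiff (z i)] with k hk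
    refine Finset.sum_congr rfl fun i _ => ?_
    by_cases hm : z i ∈ {z : EuclideanSpace ℝ (Fin d) × Y | z.1 ∈ slab v a b} ∩ A
    · rw [Set.indicator_of_mem ((hk i).2 hm), Set.indicator_of_mem hm]
    · rw [Set.indicator_of_notMem (fun h => hm ((hk i).1 h)), Set.indicator_of_notMem hm]
  have hmeas := tendsto_measure_of_tendsto_indicator_of_isFiniteMeasure Filter.atTop (μ := P)
    (As := fun k => {z : EuclideanSpace ℝ (Fin d) × Y | z.1 ∈ slab (w k) (α k) (β k)} ∩ A)
    (A := {z : EuclideanSpace ℝ (Fin d) × Y | z.1 ∈ slab v a b} ∩ A)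
    (fun k => (measurable_fst (measurableSet_slab _ _ _)).inter hA) hiff
  have hreal := (ENNReal.tendsto_toReal (measure_ne_top _ _)).comp hmeas
  refine le_of_tendsto (((hreal.const_mul (n : ℝ)).sub_const _).abs) ?_
  filter_upwards [hcount] with k hk
  have := h (w k) (hw k) (α k) (β k)
  rw [hk] at this
  exact this

/-! ### From counts to conditional coverage, and constants -/

theorem empiricalDist_real {Z : Type*} [MeasurableSpace Z] {n : ℕ} (z : Fin n → Z) {B : Set Z}
    (hB : MeasurableSet B) : (empiricalDist z).real B = hitCount B z / n := by
  rw [empiricalDist, measureReal_ennreal_smul_apply, measureReal_def, Measure.finsetSum_apply,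
    ENNReal.toReal_sum (fun i _ => measure_ne_top _ _)]
  simp only [Measure.dirac_apply' _ hB, hitCount]
  rw [div_eq_inv_mul]
  congr 1
  · simp
  · refine Finset.sum_congr rfl fun i _ => ?_
    by_cases h : z i ∈ B <;> simp [h]

theorem condCoverage_eq {X Y : Type*} [MeasurableSpace X] [MeasurableSpace Y]
    (Q : Measure (X × Y)) (C : X → Set Y) {S : Set X} (hS : MeasurableSet S) :
    condCoverage Q C S
      = (Q.real {z | z.1 ∈ S})⁻¹ * Q.real ({z | z.1 ∈ S} ∩ {z | z.2 ∈ C z.1}) := by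
  have hS' : MeasurableSet {z : X × Y | z.1 ∈ S} := measurable_fst hS
  rw [condCoverage, measureReal_def, cond_apply hS', ENNReal.toReal_mul,
    ENNReal.toReal_inv]
  rfl

/-- With c = p'/p, the identity k' - k c = c (n p - k) - (n p' - k') reduces the ratio to the two
count deviations, and c ≤ 1. -/
theorem abs_ratio_sub_le {n k k' p p' r L δ : ℝ} (hn : 0 < n) (hδ : 0 < δ) (hL : 0 ≤ L)
    (hr0 : 0 ≤ r) (hr : r ^ 2 = 26 * L) (hk : δ * n ≤ k) (hk0 : 0 ≤ k') (hkk : k' ≤ k)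
    (hp0 : 0 ≤ p') (hpp : p' ≤ p)
    (h : |n * p - k| ≤ 5 * r * (Real.sqrt k + r)) (h' : |n * p' - k'| ≤ 5 * r * (Real.sqrt k' + r)) :
    |(k / n)⁻¹ * (k' / n) - p⁻¹ * p'| ≤ 400 * Real.sqrt (L / (δ * n)) := by
  have hδn : 0 < δ * n := mul_pos hδ hn
  have hkpos : 0 < k := hδn.trans_le hk
  have hratio : (k / n)⁻¹ * (k' / n) = k' / k := by field_simp
  -- If p = 0 then p' = 0 too, so p' = p c survives the convention c = 0.
  obtain ⟨c, hc0, hc1, hcp, hc⟩ : ∃ c : ℝ, 0 ≤ c ∧ c ≤ 1 ∧ p' = p * c ∧ p⁻¹ * p' = c := by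
    refine ⟨p⁻¹ * p', mul_nonneg (inv_nonneg.2 (hp0.trans hpp)) hp0, ?_, ?_, rfl⟩
    · rw [inv_mul_eq_div]; exact div_le_one_of_le₀ hpp (hp0.trans hpp)
    · rcases (hp0.trans hpp).eq_or_lt with h0 | h0
      · rw [← h0] at hpp ⊢; rw [le_antisymm hpp hp0]; simp
      · rw [mul_inv_cancel_left₀ h0.ne']
  rw [hratio, hc]
  set x := Real.sqrt (L / (δ * n)) with hx
  have hx0 : 0 ≤ x := Real.sqrt_nonneg _
  have hq0 : 0 ≤ k' / k := by positivity
  have hq1 : k' / k ≤ 1 := div_le_one_of_le₀ hkk hkpos.le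
  -- Both ratios lie in [0, 1], so only x < 1/400 is at stake; then 60 x (1 + 6x) ≤ 400 x below.
  by_cases hx1 : 1 ≤ 400 * x
  · exact (abs_le.2 ⟨by linarith, by linarith⟩).trans hx1
  have hxL : x ^ 2 * (δ * n) = L := by
    rw [hx, Real.sq_sqrt (by positivity), div_mul_cancel₀ _ hδn.ne']
  have hrx : r ≤ 6 * x * Real.sqrt k := by
    refine le_of_sq_le_sq ?_ (by positivity)
    rw [mul_pow, Real.sq_sqrt hkpos.le, hr, ← hxL]
    nlinarith [mul_le_mul_of_nonneg_left hk (sq_nonneg x), mul_nonneg (sq_nonneg x) hkpos.le]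
  have hs : Real.sqrt k' ≤ Real.sqrt k := Real.sqrt_le_sqrt hkk
  have hdev : |k' - k * c| ≤ 10 * r * (Real.sqrt k + r) := by
    have he : k' - k * c = c * (n * p - k) - (n * p' - k') := by rw [hcp]; ring
    rw [he]
    refine (abs_sub _ _).trans ?_
    rw [abs_mul, abs_of_nonneg hc0]
    have h1 : c * |n * p - k| ≤ 1 * (5 * r * (Real.sqrt k + r)) := by gcongr
    have h2 : |n * p' - k'| ≤ 5 * r * (Real.sqrt k + r) := h'.trans (by gcongr)
    linarith
  have hfin : 10 * r * (Real.sqrt k + r) ≤ 400 * x * k := by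
    calc 10 * r * (Real.sqrt k + r)
        ≤ 10 * (6 * x * Real.sqrt k) * (Real.sqrt k + 6 * x * Real.sqrt k) := by gcongr
      _ = 60 * x * (1 + 6 * x) * Real.sqrt k ^ 2 := by ring
      _ ≤ 400 * x * k := by
          rw [Real.sq_sqrt hkpos.le]
          have hxk : 0 ≤ x * k := by positivity
          nlinarith [not_le.1 hx1]
  have : k' / k - c = (k' - k * c) / k := by field_simp
  rw [this, abs_div, abs_of_pos hkpos, div_le_iff₀ hkpos]
  exact hdev.trans hfin

/-- Source of the 26: 4n² + 1 ≤ n⁵ and v + 1 ≤ 2D bound the traces by n^(10D), and 8 ≤ n³ absorbs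
the factor 4 and the halving, so r²/2 must contain 13 D log n. The halving pays for the two families
of sets. -/
theorem growth_mul_exp_le {n v : ℕ} (hn : 2 ≤ n) {t r : ℝ} (ht : 0 < t)
    (hr : r ^ 2 = 26 * (max 1 (v : ℝ) * Real.log n + t)) :
    ((((n + n) ^ 2 + 1) ^ (v + 1) : ℕ) : ℝ) * (4 * Real.exp (-(r ^ 2 / 2)))
      ≤ Real.exp (-t) / 2 := by
  set D := max 1 (v : ℝ)
  have hD1 : 1 ≤ D := le_max_left _ _
  have hDv : (v : ℝ) ≤ D := le_max_right _ _
  have hn0 : (0 : ℝ) < n := by positivity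
  have hlog : 0 ≤ Real.log n := Real.log_natCast_nonneg n
  have h3 : 2 ^ 3 ≤ n ^ 3 := Nat.pow_le_pow_left hn 3
  have h5 : (n + n) ^ 2 + 1 ≤ n ^ 5 := by
    have : n ^ 5 = n ^ 3 * n ^ 2 := by ring
    nlinarith [Nat.pow_le_pow_left hn 2]
  have hN : ((((n + n) ^ 2 + 1) ^ (v + 1) : ℕ) : ℝ) ≤ Real.exp (10 * D * Real.log n) := by
    calc ((((n + n) ^ 2 + 1) ^ (v + 1) : ℕ) : ℝ) ≤ (((n ^ 5) ^ (v + 1) : ℕ) : ℝ) := by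
          exact_mod_cast Nat.pow_le_pow_left h5 _
      _ = Real.exp (5 * (v + 1) * Real.log n) := by
          rw [← pow_mul, Nat.cast_pow, ← Real.exp_log hn0, ← Real.exp_nat_mul, Real.log_exp]
          push_cast; ring_nf
      _ ≤ _ := by
          rw [Real.exp_le_exp]
          exact mul_le_mul_of_nonneg_right (by linarith) hlog
  have h8 : (8 : ℝ) ≤ Real.exp (3 * D * Real.log n) := by
    calc (8 : ℝ) ≤ (n : ℝ) ^ 3 := by exact_mod_cast h3
      _ = Real.exp (3 * Real.log n) := by
          rw [← Real.exp_log hn0, ← Real.exp_nat_mul, Real.log_exp]; norm_num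
      _ ≤ _ := by
          rw [Real.exp_le_exp]
          exact mul_le_mul_of_nonneg_right (by linarith) hlog
  calc _ ≤ Real.exp (10 * D * Real.log n) * (4 * Real.exp (-(r ^ 2 / 2))) := by gcongr
    _ = 8 * Real.exp (10 * D * Real.log n) * Real.exp (-(r ^ 2 / 2)) / 2 := by ring
    _ ≤ Real.exp (3 * D * Real.log n) * Real.exp (10 * D * Real.log n)
          * Real.exp (-(r ^ 2 / 2)) / 2 := by gcongr
    _ = Real.exp (-(13 * t)) / 2 := by
        rw [← Real.exp_add, ← Real.exp_add, hr]; ring_nf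
    _ ≤ _ := by gcongr; linarith

/-! ### The main theorem -/

/-- `T` is the information from which the confidence set is built (its score `s (T ω)` and threshold
`q (T ω)`), independent of the sample `Z`. "With probability at least `1 - exp (-t)`" is stated as
the bound `exp (-t)` on the (outer) measure of the complementary event, which needs no measurability
of the supremum over slabs. -/
theorem mainTheorem8 :
    ∃ K : ℝ, 0 < K ∧
      ∀ (d : ℕ) (V : Set (EuclideanSpace ℝ (Fin d)))
        (Y : Type*) [MeasurableSpace Y]
        (Θ : Type*) [MeasurableSpace Θ]
        (Ω : Type*) [MeasurableSpace Ω] (μ : Measure Ω) [IsProbabilityMeasure μ]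
        (P : Measure (EuclideanSpace ℝ (Fin d) × Y)) [IsProbabilityMeasure P]
        (n : ℕ) (_ : 2 ≤ n)
        (Z : Fin n → Ω → EuclideanSpace ℝ (Fin d) × Y)
        (_ : ∀ i, Measurable (Z i)) (_ : ∀ i, μ.map (Z i) = P) (_ : iIndepFun Z μ)
        (T : Ω → Θ) (_ : Measurable T) (_ : IndepFun T (fun ω i => Z i ω) μ)
        (s : Θ → EuclideanSpace ℝ (Fin d) → Y → ℝ) (q : Θ → EuclideanSpace ℝ (Fin d) → ℝ)
        (_ : MeasurableSet {w : Θ × (EuclideanSpace ℝ (Fin d) × Y) |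
          w.2.2 ∈ thresholdSet (s w.1) (q w.1) w.2.1})
        (δ : ℝ) (_ : 0 < δ) (_ : δ ≤ 1) (t : ℝ) (_ : 0 < t),
        VC V ≤ (d : ℕ∞) ∧ ((VC V).toNat : ℝ) ≤ minDimLogCard V ∧
        μ {ω | ¬ ∀ v ∈ V, ∀ a b : ℝ, a ≤ b →
            δ ≤ slabMass (empiricalDist fun i => Z i ω) (slab v a b) →
            |condCoverage (empiricalDist fun i => Z i ω)
                  (thresholdSet (s (T ω)) (q (T ω))) (slab v a b)
                - condCoverage P (thresholdSet (s (T ω)) (q (T ω))) (slab v a b)|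
              ≤ K * Real.sqrt ((max 1 ((VC V).toNat : ℝ) * Real.log n + t) / (δ * n))}
          ≤ ENNReal.ofReal (Real.exp (-t)) ∧
        K * Real.sqrt ((max 1 ((VC V).toNat : ℝ) * Real.log n + t) / (δ * n))
          ≤ K * Real.sqrt ((max 1 (minDimLogCard V) * Real.log n + t) / (δ * n)) := by
  refine ⟨400, by norm_num, ?_⟩
  intro d V Y _ Θ _ Ω _ μ _ P _ n hn Z hZ hlaw hind T hT hTZ s q hsq δ hδ hδ1 t ht
  have hmin := VC_toNat_le_minDimLogCard V
  have hlog : 0 ≤ Real.log n := Real.log_natCast_nonneg n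
  have hn0 : (0 : ℝ) < n := by positivity
  refine ⟨VC_le_dim V, hmin, ?_, by gcongr⟩
  set L := max 1 ((VC V).toNat : ℝ) * Real.log n + t with hL
  -- Ensures r ≥ 1, as the ghost sample comparison requires; it follows from n ≥ 2.
  have hL0 : 1 / 26 ≤ L := by
    have h2 : Real.log 2 ≤ Real.log n := Real.log_le_log two_pos (by exact_mod_cast hn)
    have h3 : Real.log n ≤ max 1 ((VC V).toNat : ℝ) * Real.log n :=
      le_mul_of_one_le_left hlog (le_max_left _ _)
    have := Real.log_two_gt_d9
    linarith
  set r := Real.sqrt (26 * L) with hr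
  have hr2 : r ^ 2 = 26 * L := Real.sq_sqrt (by linarith)
  have hr1 : 1 ≤ r := Real.one_le_sqrt.2 (by linarith)
  obtain ⟨V₀, hV₀V, hV₀c, hV₀d⟩ :=
    (TopologicalSpace.IsSeparable.of_separableSpace V).exists_countable_dense_subset
  have : Countable V₀ := hV₀c.to_subtype
  set C : Θ → Set (EuclideanSpace ℝ (Fin d) × Y) :=
    fun θ => {z | z.2 ∈ thresholdSet (s θ) (q θ) z.1} with hC
  have hCm : ∀ θ, MeasurableSet (C θ) := fun θ => measurable_prodMk_left hsq
  have hslab : ∀ {W : Type _} [MeasurableSpace W] (v : EuclideanSpace ℝ (Fin d)) (a b : ℝ)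
      (f : W → EuclideanSpace ℝ (Fin d)), Measurable f → MeasurableSet {w | f w ∈ slab v a b} :=
    fun v a b f hf => hf (measurableSet_slab v a b)
  -- Used twice: the whole space as `A` gives the slab counts, the confidence set gives the covered
  -- counts.
  have hdev : ∀ A : Set (Θ × (EuclideanSpace ℝ (Fin d) × Y)), MeasurableSet A →
      μ {ω | ∃ i : V₀ × ℚ × ℚ,
        5 * r * (Real.sqrt (hitCount ({z | z.1 ∈ slab (i.1 : EuclideanSpace ℝ (Fin d)) i.2.1 i.2.2}
            ∩ Prod.mk (T ω) ⁻¹' A) fun j => Z j ω) + r)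
        < |n * P.real ({z | z.1 ∈ slab (i.1 : EuclideanSpace ℝ (Fin d)) i.2.1 i.2.2}
            ∩ Prod.mk (T ω) ⁻¹' A)
          - hitCount ({z | z.1 ∈ slab (i.1 : EuclideanSpace ℝ (Fin d)) i.2.1 i.2.2}
            ∩ Prod.mk (T ω) ⁻¹' A) fun j => Z j ω|}
      ≤ ENNReal.ofReal (Real.exp (-t) / 2) := by
    intro A hA
    refine (measure_section_deviation_le P μ hZ hlaw hind hT hTZ
      (fun i : V₀ × ℚ × ℚ =>
        {w | w.2.1 ∈ slab (i.1 : EuclideanSpace ℝ (Fin d)) i.2.1 i.2.2} ∩ A)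
      (fun i => (hslab _ _ _ _ (by fun_prop)).inter hA)
      (N := ((n + n) ^ 2 + 1) ^ ((VC V).toNat + 1)) (fun θ y => ?_) hr1).trans
      (ENNReal.ofReal_le_ofReal (growth_mul_exp_le hn ht hr2))
    have hcard := card_slab_traces_le V fun u => (y u).1
    rw [Fintype.card_sum, Fintype.card_fin] at hcard
    -- For frozen θ, each trace is a slab trace cut by one fixed set, so there are no more of them.
    have hsub : {p : Set (Fin n ⊕ Fin n) | ∃ i : V₀ × ℚ × ℚ, p = {u | (θ, y u) ∈
        {w : Θ × (EuclideanSpace ℝ (Fin d) × Y) |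
          w.2.1 ∈ slab (i.1 : EuclideanSpace ℝ (Fin d)) i.2.1 i.2.2} ∩ A}}
        ⊆ (fun p => p ∩ {u | (θ, y u) ∈ A}) ''
          {p | ∃ v ∈ V, ∃ a b : ℝ, p = {u | (y u).1 ∈ slab v a b}} := by
      rintro p ⟨i, rfl⟩
      exact ⟨_, ⟨i.1, hV₀V i.1.2, i.2.1, i.2.2, rfl⟩, rfl⟩
    exact ((Set.ncard_le_ncard hsub (Set.toFinite _)).trans
      (Set.ncard_image_le (Set.toFinite _))).trans hcard
  refine (measure_mono (fun ω hω => ?_)).trans ((measure_union_le _ _).trans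
    ((add_le_add (hdev Set.univ MeasurableSet.univ) (hdev _ hsq)).trans (le_of_eq ?_)))
  · by_contra hgood
    obtain ⟨hg1, hg2⟩ := not_or.1 hgood
    refine hω fun v hv a b _ hmass => ?_
    have h1 := slab_deviation_le_of_dense P MeasurableSet.univ (fun j => Z j ω) (r := r)
      (fun w hw α β => not_lt.1 fun h => hg1 ⟨(⟨w, hw⟩, α, β), h⟩) (hV₀d hv) a b
    have h2 := slab_deviation_le_of_dense P (hCm (T ω)) (fun j => Z j ω) (r := r)
      (fun w hw α β => not_lt.1 fun h => hg2 ⟨(⟨w, hw⟩, α, β), h⟩) (hV₀d hv) a b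
    rw [Set.inter_univ] at h1
    have hSm : MeasurableSet {z : EuclideanSpace ℝ (Fin d) × Y | z.1 ∈ slab v a b} :=
      measurable_fst (measurableSet_slab v a b)
    rw [slabMass, empiricalDist_real _ hSm, le_div_iff₀ hn0] at hmass
    rw [condCoverage_eq _ _ (measurableSet_slab v a b), condCoverage_eq _ _ (measurableSet_slab v a b),
      empiricalDist_real _ hSm, empiricalDist_real _ (hSm.inter (hCm (T ω)))]
    exact abs_ratio_sub_le hn0 hδ (by linarith) (by linarith) hr2 hmass (hitCount_nonneg _ _)
      (hitCount_mono Set.inter_subset_left _) measureReal_nonneg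
      (measureReal_mono Set.inter_subset_left) h1 h2
  · rw [← ENNReal.ofReal_add (by positivity) (by positivity), add_halves]
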